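/- Let $X$ be a Hausdorff real locally convex space with topology $\tau$, and let $X^*$ be its topological dual with the weak-star topology $\omega^*$. Write $c(x,x^*)=\langle x,x^*\rangle$. Identify an operator $T:X\rightrightarrows X^*$ with its graph, let $D(T)=\{x: Tx\neq\emptyset\}$, and for $V\subset X$ let $T|_V$ be the operator with graph $T\cap(V\times X^*)$. The Fitzpatrick function of $T$ is $$\varphi_T(x,x^*)=\sup\{\langle x,u^*\rangle+\langle u,x^*\rangle-\langle u,u^*\rangle : (u,u^*)\in T\}\in[-\infty,+\infty]\qquad(\sup\emptyset=-\infty).$$ For functions $f,g$ on $X\times X^*$, $[f\le g]$ and $[f=g]$ denote the sets where the relation holds, and $\operatorname{Pr}_X$ is the projection of $X\times X^*$ onto $X$. The operator $T$ is monotone if $\langle x-y,x^*-y^*\rangle\ge0$ for all $(x,x^*),(y,y^*)\in T$, and maximal monotone if, moreover, its graph has no proper monotone extension. For $V\subset X$ we say that * $V$ *locates* $T$ if $\operatorname{Pr}_X[\varphi_{T|_V}\le c]\cap V\subset D(T)$; * $V$ *identifies* $T$ if $[\varphi_{T|_V}\le c]\cap(V\times X^*)\subset T$; * $T$ is *$V$-NI*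 if $\varphi_{T|_V}\ge c$ on $V\times X^*$; * $T$ is *$V$-representable* if $V\cap D(T)\ne\emptyset$ and there is a proper convex $\tau\times\omega^*$-lower semicontinuous function $h:X\times X^*\to\overline{\mathbb R}$ with $h\ge c$ and $[h=c]\cap(V\times X^*)=T|_V$. For non-empty $C\subset X$, the normal cone $N_C=\partial\iota_C$ is given by $N_C(x)=\{x^*:\langle y-x,x^*\rangle\le0\ \forall y\in C\}$ for $x\in C$ and $N_C(x)=\emptyset$ for $x\notin C$; $(T+N_C)(x)=Tx+N_C(x)$. **Theorem.** Let $T:X\rightrightarrows X^*$, let $C\subset X$ be closed and convex with $D(T)\cap\operatorname{int}C\neq\emptyset$, and let $T$ be $C$-representable. Then the following are equivalent: (i) $C$ locates $T$; (ii) $T$ is $C$-NI; (iii) $[\varphi_{T|_C}\le c]\cap(C\times X^*)\subset T+N_C$; (iv) $C$ identifies $T+N_C$. Moreover, $T+N_C$ is maximal monotone if and only if $C$ locates $T$ and $[\varphi_{T+N_C}\le c]\subset C\times X^*$, and also if and only if $T$ is $C$-NI and $[\varphi_{T+N_C}\le c]\subset C\times X^*$. -/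

import Mathlib

open scoped Pointwise

namespace MonotoneOp

section Defs

variable {X : Type*} [AddCommGroup X] [Module ℝ X] [TopologicalSpace X]

/-- The graph of a multi-valued operator from `X` to its topological dual. The dual is Mathlib's
`WeakDual ℝ X`, i.e. the space of continuous linear functionals with the weak-star topology. -/
def graph (T : X → Set (WeakDual ℝ X)) : Set (X × WeakDual ℝ X) :=
  {z | z.2 ∈ T z.1}

/-- The domain of a multi-valued operator. -/
def dom (T : X → Set (WeakDual ℝ X)) : Set X :=
  {x | (T x).Nonempty}

/-- The restriction of `T` to `V`, whose graph is `graph T ∩ (V × X*)`. -/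
def restrict (T : X → Set (WeakDual ℝ X)) (V : Set X) : X → Set (WeakDual ℝ X) :=
  fun x => {p | x ∈ V ∧ p ∈ T x}

/-- The sum of two operators: `(S + T) x = S x + T x` (Minkowski sum, empty if one of the two
values is empty). -/
def sum (S T : X → Set (WeakDual ℝ X)) : X → Set (WeakDual ℝ X) :=
  fun x => S x + T x

/-- The duality product `c (x, x*) = ⟨x, x*⟩`. -/
noncomputable def coupling (z : X × WeakDual ℝ X) : ℝ :=
  z.2 z.1

/-- The natural coupling of `X × X*` with itself:
`(x, x*) · (y, y*) = ⟨x, y*⟩ + ⟨y, x*⟩`. -/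
noncomputable def natPairing (z w : X × WeakDual ℝ X) : ℝ :=
  w.2 z.1 + z.2 w.1

/-- The Fitzpatrick function of `T`:
`φ_T z = sup {z · w - c w | w ∈ graph T}`, with `sup ∅ = -∞`. -/
noncomputable def fitzpatrick (T : X → Set (WeakDual ℝ X)) (z : X × WeakDual ℝ X) : EReal :=
  ⨆ w ∈ graph T, ((natPairing z w - coupling w : ℝ) : EReal)

/-- The set `[φ_T ≤ c]`, i.e. the set of all points that are monotonically related to `T`. -/
def monRelated (T : X → Set (WeakDual ℝ X)) : Set (X × WeakDual ℝ X) :=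
  {z | fitzpatrick T z ≤ (coupling z : EReal)}

/-- Monotone operators. -/
def IsMonotone (T : X → Set (WeakDual ℝ X)) : Prop :=
  ∀ z ∈ graph T, ∀ w ∈ graph T, 0 ≤ (z.2 - w.2) (z.1 - w.1)

/-- Maximal monotone operators; maximality is in the sense of graph inclusion. -/
def IsMaximalMonotone (T : X → Set (WeakDual ℝ X)) : Prop :=
  IsMonotone T ∧
    ∀ S : X → Set (WeakDual ℝ X), IsMonotone S → graph T ⊆ graph S → graph S = graph T

/-- The indicator function of a set: `0` on the set and `+∞` off it. -/
noncomputable def indicatorFun (C : Set X) (x : X) : EReal :=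
  open scoped Classical in if x ∈ C then 0 else ⊤

/-- The subdifferential of a (proper) function `f`:
`∂f x = {p | ⟨y - x, p⟩ + f x ≤ f y for all y}`. -/
def subdifferential (f : X → EReal) : X → Set (WeakDual ℝ X) :=
  fun x => {p | ∀ y : X, ((p (y - x) : ℝ) : EReal) + f x ≤ f y}

/-- The normal cone to a (non-empty) set `C`: the subdifferential of its indicator function. -/
noncomputable def normalCone (C : Set X) : X → Set (WeakDual ℝ X) :=
  subdifferential (indicatorFun C)

/-- The class of representative functions: proper, convex, lower semicontinuous functions
`h` on `X × X*` (with the product of the topology of `X` and the weak-star topology)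
such that `h ≥ c`. Convexity is convexity of the epigraph. -/
structure IsRepresentative (h : X × WeakDual ℝ X → EReal) : Prop where
  exists_lt_top : ∃ z, h z < ⊤
  ne_bot : ∀ z, h z ≠ ⊥
  convex_epi : Convex ℝ {p : (X × WeakDual ℝ X) × ℝ | h p.1 ≤ (p.2 : EReal)}
  lsc : LowerSemicontinuous h
  coupling_le : ∀ z, (coupling z : EReal) ≤ h z

/-- `T` is `V`-representable: `V` meets the domain of `T` and there is a representative
function `h` with `[h = c] ∩ (V × X*) = graph (T|_V)`. -/
def IsRepresentableOn (T : X → Set (WeakDual ℝ X)) (V : Set X) : Prop :=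
  (V ∩ dom T).Nonempty ∧
    ∃ h : X × WeakDual ℝ X → EReal, IsRepresentative h ∧
      {z | h z = (coupling z : EReal)} ∩ V ×ˢ Set.univ = graph (restrict T V)

/-- `V` identifies `T`: `[φ_{T|_V} ≤ c] ∩ (V × X*) ⊆ graph T`. -/
def Identifies (V : Set X) (T : X → Set (WeakDual ℝ X)) : Prop :=
  monRelated (restrict T V) ∩ V ×ˢ Set.univ ⊆ graph T

/-- `V` locates `T` in `S`: `Pr_X [φ_{T|_V} ≤ c] ∩ V ⊆ S`. -/
def LocatesIn (V : Set X) (T : X → Set (WeakDual ℝ X)) (S : Set X) : Prop :=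
  Prod.fst '' monRelated (restrict T V) ∩ V ⊆ S

/-- `V` locates `T`: `V` locates `T` in the domain of `T`. -/
def Locates (V : Set X) (T : X → Set (WeakDual ℝ X)) : Prop :=
  LocatesIn V T (dom T)

/-- `T` is `V`-NI (of negative-infimum type on `V`): `V × X* ⊆ [φ_{T|_V} ≥ c]`. -/
def IsNIOn (T : X → Set (WeakDual ℝ X)) (V : Set X) : Prop :=
  V ×ˢ Set.univ ⊆ {z | (coupling z : EReal) ≤ fitzpatrick (restrict T V) z}

end Defs

end MonotoneOp

open Filter Topology

namespace MonotoneOp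

/-! The substance is that NI forces every point `z` over `C` monotonically related to `T|_C` into `T
+ N_C`. Convolve `h`, restricted to `C × X*`, with the support function of `C` in the dual variable
(`convEpi`). The result still dominates the coupling, and over `C` it touches it only on `T + N_C`.
An interior point `u` of `C` in the domain bounds the convolution variables, so Banach–Alaoglu makes
the epigraph closed (`isClosed_convEpi`).

If `z` is not in `T + N_C`, Hahn–Banach yields `w` over `C` with `φ_{T|_C}(w) ≤ b < z · w - c z`
(`exists_separation`). Convexity of `φ_{T|_C}` along the segment from `z` to `w`, which stays over
`C`, then contradicts NI to first order at `z` (`subset_graph_of_isNIOn`).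

The other implications are direct. Over `C`, adding normal vectors does not change which points are
monotonically related, so maximality of `T + N_C` only adds the demand that no related point lies
off `C × X*`. -/

theorem le_of_forall_add_mul_le {A B r : ℝ} (h : ∀ t : ℝ, 0 < t → t < 1 → A + t * B ≤ r) :
    A ≤ r := by
  have hlim : Tendsto (fun t : ℝ => A + t * B) (𝓝[>] 0) (𝓝 A) := by
    have hc : Continuous fun t : ℝ => A + t * B := by fun_prop
    simpa using (hc.tendsto 0).mono_left nhdsWithin_le_nhds
  refine le_of_tendsto hlim ?_
  filter_upwards [Ioo_mem_nhdsGT (zero_lt_one' ℝ)] with t ht using h t ht.1 ht.2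

/-! ### Weak-star compactness -/

section WeakDual

variable {X : Type*} [AddCommGroup X] [Module ℝ X] [TopologicalSpace X]

theorem weakDual_add_apply (p q : WeakDual ℝ X) (x : X) : (p + q) x = p x + q x := rfl

theorem weakDual_sub_apply (p q : WeakDual ℝ X) (x : X) : (p - q) x = p x - q x := rfl

theorem weakDual_smul_apply (a : ℝ) (p : WeakDual ℝ X) (x : X) : (a • p) x = a * p x := rfl

variable [ContinuousSMul ℝ X]

theorem absorb_bound {U : Set X} (hU : U ∈ 𝓝 (0 : X)) (x : X) :
    ∃ a : ℝ, 0 < a ∧ a • x ∈ U := by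
  have hc : Tendsto (fun a : ℝ => a • x) (𝓝[>] 0) (𝓝 0) := by
    have : Continuous fun a : ℝ => a • x := by fun_prop
    simpa using (this.tendsto 0).mono_left nhdsWithin_le_nhds
  obtain ⟨a, ha, h0⟩ := ((hc.eventually hU).and self_mem_nhdsWithin).exists
  exact ⟨a, h0, ha⟩

/-- The Banach-Alaoglu theorem: a set of functionals which are uniformly bounded on a
neighbourhood of zero is weak-star relatively compact. -/
theorem isCompact_equibounded [IsTopologicalAddGroup X] {U : Set X} (hU : U ∈ 𝓝 (0 : X)) (M : ℝ) :
    IsCompact {n : WeakDual ℝ X | ∀ v ∈ U, |n v| ≤ M} := by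
  rw [isCompact_iff_ultrafilter_le_nhds]
  intro F hF
  rw [le_principal_iff] at hF
  have hlim : ∀ x : X, ∃ l : ℝ, Tendsto (fun n : WeakDual ℝ X => n x) F (𝓝 l) := by
    intro x
    obtain ⟨a, ha, hax⟩ := absorb_bound hU x
    have hmem : Set.Icc (-(M / a)) (M / a) ∈ F.map (fun n : WeakDual ℝ X => n x) := by
      rw [Ultrafilter.mem_map]
      filter_upwards [hF] with n hn
      have h1 := hn _ hax
      rw [map_smul, smul_eq_mul, abs_mul, abs_of_pos ha] at h1
      have h2 : |n x| ≤ M / a := by rw [le_div_iff₀ ha]; linarith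
      exact abs_le.1 h2
    obtain ⟨l, -, hl⟩ := isCompact_iff_ultrafilter_le_nhds.1 isCompact_Icc _
      (le_principal_iff.2 hmem)
    exact ⟨l, hl⟩
  choose L hL using hlim
  -- The pointwise limit along the ultrafilter is linear; being bounded by `M` on `U`, it is
  -- continuous.
  let φ : X →ₗ[ℝ] ℝ :=
    { toFun := L
      map_add' := fun x y => tendsto_nhds_unique (hL (x + y)) <| by
        simpa only [map_add] using (hL x).add (hL y)
      map_smul' := fun a x => tendsto_nhds_unique (hL (a • x)) <| by
        simpa only [map_smul, smul_eq_mul, RingHom.id_apply] using (hL x).const_mul a }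
  have hbound : ∀ v ∈ U, |L v| ≤ M := fun v hv =>
    le_of_tendsto (hL v).abs (by filter_upwards [hF] with n hn using hn v hv)
  let φc : X →L[ℝ] ℝ := φ.clmOfExistsBoundedImage
    ⟨U, hU, (NormedSpace.isVonNBounded_of_isBounded ℝ (Metric.isBounded_Icc (-M) M)).subset <| by
      rintro _ ⟨v, hv, rfl⟩
      exact abs_le.1 (hbound v hv)⟩
  refine ⟨StrongDual.toWeakDual φc, hbound, ?_⟩
  have h1 : Tendsto (fun n : WeakDual ℝ X => n) F (𝓝 (StrongDual.toWeakDual φc)) :=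
    (Topology.IsInducing.tendsto_nhds_iff ⟨rfl⟩).2 (tendsto_pi_nhds.2 hL)
  exact h1

end WeakDual

/-! ### Representative functions and convolution with the support function -/

section Representative

variable {X : Type*} [AddCommGroup X] [Module ℝ X] [TopologicalSpace X]
  {h : X × WeakDual ℝ X → EReal}

/-- A representative function is minorized by the affine function attached to any of its
points of contact with the coupling. -/
theorem IsRepresentative.natPairing_sub_coupling_le (hh : IsRepresentative h)
    {w : X × WeakDual ℝ X} (hw : h w = (coupling w : EReal)) {v : X × WeakDual ℝ X} {r : ℝ}
    (hv : h v ≤ (r : EReal)) : natPairing v w - coupling w ≤ r := by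
  -- Compare `h` and `c` at `(1 - t) w + t v`, divide by `t` and let `t → 0`; `B` collects the terms
  -- of second order in `t`.
  refine le_of_forall_add_mul_le (B := coupling v - (natPairing v w - coupling w)) ?_
  intro t ht0 ht1
  have hconv := hh.convex_epi (x := (w, coupling w)) hw.le (y := (v, r)) hv
    (sub_nonneg.2 ht1.le) ht0.le (by ring)
  have hc := EReal.coe_le_coe_iff.1 ((hh.coupling_le _).trans hconv)
  obtain ⟨w, w'⟩ := w
  obtain ⟨v, v'⟩ := v
  simp only [coupling, natPairing, Prod.fst_add, Prod.snd_add, Prod.smul_fst, Prod.smul_snd,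
    map_add, map_smul, weakDual_add_apply, weakDual_smul_apply, smul_eq_mul] at hc ⊢
  refine le_of_mul_le_mul_left ?_ ht0
  linarith

theorem IsRepresentative.monotone (hh : IsRepresentative h) {z w : X × WeakDual ℝ X}
    (hz : h z = (coupling z : EReal)) (hw : h w = (coupling w : EReal)) :
    0 ≤ (z.2 - w.2) (z.1 - w.1) := by
  have := hh.natPairing_sub_coupling_le hw hz.le
  simp only [coupling, natPairing] at this
  rw [weakDual_sub_apply, map_sub, map_sub]
  linarith

theorem IsRepresentative.isClosed_epi (hh : IsRepresentative h) :
    IsClosed {p : (X × WeakDual ℝ X) × ℝ | h p.1 ≤ (p.2 : EReal)} :=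
  hh.lsc.isClosed_epigraph.preimage
    (continuous_fst.prodMk (continuous_coe_real_ereal.comp continuous_snd))

/-- The epigraph of the function obtained from `h` restricted to `C × X*` by infimal convolution,
in the second variable, with the support function of `C`. The support function is expressed by
its values on `C - u`. -/
def convEpi (h : X × WeakDual ℝ X → EReal) (C : Set X) (u : X) :
    Set ((X × WeakDual ℝ X) × ℝ) :=
  {p | ∃ (n : WeakDual ℝ X) (d : ℝ), p.1.1 ∈ C ∧ (∀ y ∈ C, n (y - u) ≤ d) ∧
    h (p.1.1, p.1.2 - n) ≤ ((p.2 - d - n u : ℝ) : EReal)}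

theorem IsRepresentative.convex_convEpi (hh : IsRepresentative h) {C : Set X}
    (hC : Convex ℝ C) (u : X) : Convex ℝ (convEpi h C u) := by
  rintro p ⟨n, d, hp, hn, hnp⟩ q ⟨m, e, hq, hm, hmq⟩ a b ha hb hab
  refine ⟨a • n + b • m, a * d + b * e, hC hp hq ha hb hab, fun y hy => ?_, ?_⟩
  · rw [weakDual_add_apply, weakDual_smul_apply, weakDual_smul_apply]
    exact add_le_add (mul_le_mul_of_nonneg_left (hn y hy) ha)
      (mul_le_mul_of_nonneg_left (hm y hy) hb)
  · have hconv := hh.convex_epi (x := ((p.1.1, p.1.2 - n), p.2 - d - n u)) hnp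
      (y := ((q.1.1, q.1.2 - m), q.2 - e - m u)) hmq ha hb hab
    have e1 : (a • p + b • q).1.2 - (a • n + b • m) = a • (p.1.2 - n) + b • (q.1.2 - m) := by
      simp only [Prod.fst_add, Prod.snd_add, Prod.smul_fst, Prod.smul_snd, smul_sub]
      abel
    have e2 : (a • p + b • q).2 - (a * d + b * e) - (a • n + b • m) u =
        a * (p.2 - d - n u) + b * (q.2 - e - m u) := by
      simp only [Prod.snd_add, Prod.smul_snd, weakDual_add_apply, weakDual_smul_apply,
        smul_eq_mul]
      ring
    rw [e1, e2]
    exact hconv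

/-- Near a limit point the witnesses `(n, d)` stay in a compact set: the affine minorant of `h` at
`(u, u')` bounds `d`, and since `u` is interior, `d` bounds `n` on a neighbourhood of zero. A limit
of witnesses is then a witness for the limit point. -/
theorem IsRepresentative.isClosed_convEpi [IsTopologicalAddGroup X] [ContinuousSMul ℝ X]
    (hh : IsRepresentative h) {C : Set X}
    (hC : IsClosed C) {u : X} (hu : u ∈ interior C) {u' : WeakDual ℝ X}
    (hu' : h (u, u') = (coupling (u, u') : EReal)) : IsClosed (convEpi h C u) := by
  rw [isClosed_iff_ultrafilter]
  intro p F hFp hF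
  -- The minorant at `(u, u')` gives `d ≤ q.2 - q.1.2 u - u' q.1.1 + u' u`, the terms in `n u`
  -- cancelling; `M` is this bound at `p` with slack 1 in each varying term.
  set M : ℝ := p.2 + 1 - (p.1.2 u - 1) - (u' p.1.1 - 1) + u' u with hM
  -- Both signs are needed to bound `|n v|`, not just `n v`, by `d`.
  obtain ⟨U, hU, hUC⟩ : ∃ U ∈ 𝓝 (0 : X), ∀ v ∈ U, u + v ∈ C ∧ u + -v ∈ C := by
    have h1 : Tendsto (fun v : X => u + v) (𝓝 0) (𝓝 u) := by
      have : Continuous fun v : X => u + v := by fun_prop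
      simpa using this.tendsto 0
    have h2 : Tendsto (fun v : X => u + -v) (𝓝 0) (𝓝 u) := by
      have : Continuous fun v : X => u + -v := by fun_prop
      simpa using this.tendsto 0
    have hCu := mem_interior_iff_mem_nhds.1 hu
    exact ⟨_, (h1.eventually hCu).and (h2.eventually hCu), fun v hv => hv⟩
  choose! n d hpC hn hnp using fun (q : (X × WeakDual ℝ X) × ℝ) (hq : q ∈ convEpi h C u) => hq
  have hc1 : Continuous fun q : (X × WeakDual ℝ X) × ℝ => u' q.1.1 := by fun_prop
  have hc2 : Continuous fun q : (X × WeakDual ℝ X) × ℝ => q.1.2 u :=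
    (WeakDual.eval_continuous u).comp (continuous_snd.comp continuous_fst)
  have hbd : ∀ᶠ q in (F : Filter ((X × WeakDual ℝ X) × ℝ)), (n q, d q) ∈
      {m : WeakDual ℝ X | ∀ v ∈ U, |m v| ≤ M} ×ˢ Set.Icc 0 M := by
    filter_upwards [hF,
      ((continuous_snd.tendsto p).mono_left hFp).eventually_lt_const
        (show p.2 < p.2 + 1 by linarith),
      ((hc1.tendsto p).mono_left hFp).eventually_const_lt
        (show u' p.1.1 - 1 < u' p.1.1 by linarith),
      ((hc2.tendsto p).mono_left hFp).eventually_const_lt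
        (show p.1.2 u - 1 < p.1.2 u by linarith)] with q hq h1 h2 h3
    have h4 := hh.natPairing_sub_coupling_le hu' (hnp q hq)
    simp only [natPairing, coupling, weakDual_sub_apply] at h4
    have hd : d q ≤ M := by rw [hM]; linarith
    have hd0 : 0 ≤ d q := by simpa using hn q hq u (interior_subset hu)
    refine ⟨fun v hv => abs_le.2 ⟨?_, ?_⟩, hd0, hd⟩
    · have := hn q hq _ (hUC v hv).2
      simp only [add_sub_cancel_left, map_neg] at this
      linarith
    · have := hn q hq _ (hUC v hv).1
      simp only [add_sub_cancel_left] at this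
      linarith
  obtain ⟨⟨m, e⟩, -, hme⟩ := isCompact_iff_ultrafilter_le_nhds.1
    ((isCompact_equibounded hU M).prod isCompact_Icc) (F.map fun q => (n q, d q))
    (le_principal_iff.2 hbd)
  have hnd : Tendsto (fun q => (n q, d q)) F (𝓝 (m, e)) := hme
  have htn : Tendsto n F (𝓝 m) := (continuous_fst.tendsto _).comp hnd
  have htd : Tendsto d F (𝓝 e) := (continuous_snd.tendsto _).comp hnd
  have hev : ∀ y : X, Tendsto (fun q => n q y) F (𝓝 (m y)) := fun y =>
    ((WeakDual.eval_continuous y).tendsto m).comp htn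
  have ht1 : Tendsto (fun q : (X × WeakDual ℝ X) × ℝ => q.1.1) F (𝓝 p.1.1) :=
    ((continuous_fst.comp continuous_fst).tendsto p).mono_left hFp
  have ht2 : Tendsto (fun q : (X × WeakDual ℝ X) × ℝ => q.1.2) F (𝓝 p.1.2) :=
    ((continuous_snd.comp continuous_fst).tendsto p).mono_left hFp
  have ht3 : Tendsto (fun q : (X × WeakDual ℝ X) × ℝ => q.2) F (𝓝 p.2) :=
    (continuous_snd.tendsto p).mono_left hFp
  refine ⟨m, e, hC.mem_of_tendsto ht1 (by filter_upwards [hF] with q hq using hpC q hq),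
    fun y hy => le_of_tendsto_of_tendsto (hev (y - u)) htd
      (by filter_upwards [hF] with q hq using hn q hq y hy), ?_⟩
  exact hh.isClosed_epi.mem_of_tendsto
    ((ht1.prodMk_nhds (ht2.sub htn)).prodMk_nhds ((ht3.sub htd).sub (hev u)))
    (by filter_upwards [hF] with q hq using hnp q hq)

/-- Continuous linear functionals on `(X × X*) × ℝ` are given by elements of `(X × X*) × ℝ`. -/
theorem exists_eq_natPairing (f : StrongDual ℝ ((X × WeakDual ℝ X) × ℝ)) :
    ∃ (w : X × WeakDual ℝ X) (s : ℝ), ∀ (v : X × WeakDual ℝ X) (r : ℝ),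
      f (v, r) = natPairing v w + s * r := by
  let g : StrongDual ℝ (WeakDual ℝ X) :=
    f.comp ((ContinuousLinearMap.inl ℝ (X × WeakDual ℝ X) ℝ).comp
      (ContinuousLinearMap.inr ℝ X (WeakDual ℝ X)))
  let k : StrongDual ℝ X :=
    f.comp ((ContinuousLinearMap.inl ℝ (X × WeakDual ℝ X) ℝ).comp
      (ContinuousLinearMap.inl ℝ X (WeakDual ℝ X)))
  -- Weak-star continuous functionals on the dual are evaluations at points of `X`.
  obtain ⟨y, hy⟩ := LinearMap.dualEmbedding_surjective (topDualPairing ℝ X) g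
  have hy' : ∀ v : WeakDual ℝ X, f ((0, v), 0) = v y := fun v =>
    (DFunLike.congr_fun hy v).symm
  refine ⟨(y, StrongDual.toWeakDual k), f (0, 1), fun v r => ?_⟩
  have e : (v, r) = ((v.1, 0), (0 : ℝ)) + ((0, v.2), 0) + r • ((0 : X × WeakDual ℝ X), (1 : ℝ)) := by
    obtain ⟨a, b⟩ := v
    simp
  rw [e, map_add, map_add, map_smul, hy', smul_eq_mul, mul_comm]
  rfl

end Representative

/-! ### Monotonically related points and the sum with the normal cone -/

section Operators

variable {X : Type*} [AddCommGroup X] [Module ℝ X] [TopologicalSpace X]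
  {T : X → Set (WeakDual ℝ X)} {C : Set X}

theorem fitzpatrick_le_coe {z : X × WeakDual ℝ X} {b : ℝ} :
    fitzpatrick T z ≤ (b : EReal) ↔ ∀ w ∈ graph T, natPairing z w - coupling w ≤ b := by
  simp only [fitzpatrick, iSup_le_iff, EReal.coe_le_coe_iff]

theorem le_fitzpatrick {z w : X × WeakDual ℝ X} (hw : w ∈ graph T) :
    ((natPairing z w - coupling w : ℝ) : EReal) ≤ fitzpatrick T z :=
  le_iSup₂_of_le w hw le_rfl

theorem mem_monRelated {z : X × WeakDual ℝ X} :
    z ∈ monRelated T ↔ ∀ w ∈ graph T, natPairing z w - coupling w ≤ coupling z :=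
  fitzpatrick_le_coe

theorem mem_monRelated_iff_nonneg {z : X × WeakDual ℝ X} :
    z ∈ monRelated T ↔ ∀ w ∈ graph T, 0 ≤ (z.2 - w.2) (z.1 - w.1) := by
  rw [mem_monRelated]
  refine forall₂_congr fun w _ => ?_
  simp only [natPairing, coupling, weakDual_sub_apply, map_sub]
  constructor <;> intro h <;> linarith

/-- A monotone operator is maximal monotone if and only if it contains all the points
monotonically related to it. -/
theorem IsMonotone.isMaximalMonotone_iff (hT : IsMonotone T) :
    IsMaximalMonotone T ↔ monRelated T ⊆ graph T := by
  constructor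
  · rintro ⟨-, hmax⟩ z hz
    rw [mem_monRelated_iff_nonneg] at hz
    let S : X → Set (WeakDual ℝ X) := fun x => {p | p ∈ T x ∨ (x, p) = z}
    have hS : ∀ w, w ∈ graph S ↔ w ∈ graph T ∨ w = z := fun w => Iff.rfl
    have hsymm : ∀ v w : X × WeakDual ℝ X, (v.2 - w.2) (v.1 - w.1) = (w.2 - v.2) (w.1 - v.1) := by
      intro v w
      simp only [weakDual_sub_apply, map_sub]
      ring
    have hmon : IsMonotone S := by
      intro v hv w hw
      rcases (hS v).1 hv with hvT | rfl <;> rcases (hS w).1 hw with hwT | rfl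
      · exact hT v hvT w hwT
      · rw [hsymm]
        exact hz v hvT
      · exact hz w hwT
      · simp
    rw [← hmax S hmon fun w hw => (hS w).2 (Or.inl hw)]
    exact (hS z).2 (Or.inr rfl)
  · refine fun hmax => ⟨hT, fun S hS hTS => Set.Subset.antisymm (fun z hz => hmax ?_) hTS⟩
    exact mem_monRelated_iff_nonneg.2 fun w hw => hS z hz w (hTS hw)

theorem mem_normalCone (hC : C.Nonempty) {x : X} {p : WeakDual ℝ X} :
    p ∈ normalCone C x ↔ x ∈ C ∧ ∀ y ∈ C, p (y - x) ≤ 0 := by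
  simp only [normalCone, subdifferential, indicatorFun, Set.mem_ofPred_eq]
  constructor
  · intro h
    have hx : x ∈ C := by
      by_contra hx
      obtain ⟨u, hu⟩ := hC
      have := h u
      rw [if_neg hx, if_pos hu, EReal.coe_add_top] at this
      exact absurd this (by simp)
    refine ⟨hx, fun y hy => ?_⟩
    have := h y
    rw [if_pos hx, if_pos hy, add_zero] at this
    exact_mod_cast this
  · rintro ⟨hx, h⟩ y
    rw [if_pos hx, add_zero]
    split_ifs with hy
    · exact_mod_cast h y hy
    · exact le_top

theorem mem_graph_sum_normalCone (hC : C.Nonempty) {z : X × WeakDual ℝ X} :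
    z ∈ graph (sum T (normalCone C)) ↔
      z.1 ∈ C ∧ ∃ p ∈ T z.1, ∀ y ∈ C, (z.2 - p) (y - z.1) ≤ 0 := by
  simp only [graph, sum, Set.mem_ofPred_eq, Set.mem_add, mem_normalCone hC]
  constructor
  · rintro ⟨p, hp, n, ⟨hz, hn⟩, hpn⟩
    refine ⟨hz, p, hp, fun y hy => ?_⟩
    rw [← hpn, weakDual_sub_apply, weakDual_add_apply]
    simpa using hn y hy
  · rintro ⟨hz, p, hp, hn⟩
    exact ⟨p, hp, z.2 - p, ⟨hz, hn⟩, add_sub_cancel _ _⟩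

theorem graph_restrict_subset (hC : C.Nonempty) :
    graph (restrict T C) ⊆ graph (sum T (normalCone C)) := by
  rintro z ⟨hz, hp⟩
  exact (mem_graph_sum_normalCone hC).2 ⟨hz, z.2, hp, fun y _ => by rw [sub_self]; exact le_rfl⟩

theorem restrict_sum_normalCone (hC : C.Nonempty) :
    restrict (sum T (normalCone C)) C = sum T (normalCone C) := by
  ext x p
  refine ⟨fun h => h.2, fun h => ⟨?_, h⟩⟩
  exact ((mem_graph_sum_normalCone hC (z := (x, p))).1 h).1

theorem monRelated_sum_normalCone_subset (hC : C.Nonempty) :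
    monRelated (sum T (normalCone C)) ⊆ monRelated (restrict T C) := fun _ hz =>
  mem_monRelated.2 fun w hw => mem_monRelated.1 hz w (graph_restrict_subset hC hw)

/-- Adding a normal vector `n` at `w.1` changes `z · w - c w` by `n (z.1 - w.1)`, which is
nonpositive when `z.1 ∈ C`. -/
theorem monRelated_sum_normalCone_inter (hC : C.Nonempty) :
    monRelated (sum T (normalCone C)) ∩ C ×ˢ Set.univ =
      monRelated (restrict T C) ∩ C ×ˢ Set.univ := by
  refine Set.Subset.antisymm
    (Set.inter_subset_inter_left _ (monRelated_sum_normalCone_subset hC)) ?_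
  rintro z ⟨hz, hzC, -⟩
  refine ⟨mem_monRelated.2 fun w hw => ?_, hzC, trivial⟩
  obtain ⟨hwC, p, hp, hn⟩ := (mem_graph_sum_normalCone hC).1 hw
  have h1 := mem_monRelated.1 hz (w.1, p) ⟨hwC, hp⟩
  have h2 := hn z.1 hzC
  simp only [natPairing, coupling, weakDual_sub_apply, map_sub] at h1 h2 ⊢
  linarith

theorem identifies_sum_normalCone_iff (hC : C.Nonempty) :
    Identifies C (sum T (normalCone C)) ↔
      monRelated (restrict T C) ∩ C ×ˢ Set.univ ⊆ graph (sum T (normalCone C)) := by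
  rw [Identifies, restrict_sum_normalCone hC, monRelated_sum_normalCone_inter hC]

theorem IsMonotone.sum_normalCone (hC : C.Nonempty) (hT : IsMonotone (restrict T C)) :
    IsMonotone (sum T (normalCone C)) := by
  intro z hz w hw
  obtain ⟨hzC, p, hp, hm⟩ := (mem_graph_sum_normalCone hC).1 hz
  obtain ⟨hwC, q, hq, hn⟩ := (mem_graph_sum_normalCone hC).1 hw
  have h1 := hT (z.1, p) ⟨hzC, hp⟩ (w.1, q) ⟨hwC, hq⟩
  have h2 := hm w.1 hwC
  have h3 := hn z.1 hzC
  simp only [weakDual_sub_apply, map_sub] at h1 h2 h3 ⊢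
  linarith

/-- Where `φ_{T|_C} z < c z`, the point `z` is monotonically related to `T|_C`, so some `p ∈ T z.1`
exists; but the term of `(z.1, p)` in the supremum is exactly `c z`. -/
theorem Locates.isNIOn (h : Locates C T) : IsNIOn T C := by
  rintro z ⟨hz, -⟩
  by_contra hlt
  rw [Set.mem_ofPred_eq, not_le] at hlt
  have hrel : z ∈ monRelated (restrict T C) := hlt.le
  obtain ⟨p, hp⟩ := h ⟨⟨z, hrel, rfl⟩, hz⟩
  refine hlt.not_ge (le_trans ?_ (le_fitzpatrick (w := (z.1, p)) ⟨hz, hp⟩))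
  rw [EReal.coe_le_coe_iff]
  simp only [natPairing, coupling]
  linarith

theorem locates_of_subset_graph (hC : C.Nonempty)
    (h : monRelated (restrict T C) ∩ C ×ˢ Set.univ ⊆ graph (sum T (normalCone C))) :
    Locates C T := by
  rintro _ ⟨⟨z, hz, rfl⟩, hzC⟩
  obtain ⟨-, p, hp, -⟩ := (mem_graph_sum_normalCone hC).1 (h ⟨hz, hzC, trivial⟩)
  exact ⟨p, hp⟩

theorem natPairing_add_right (v w z : X × WeakDual ℝ X) :
    natPairing v (w + z) = natPairing v w + natPairing v z := by
  simp only [natPairing, Prod.fst_add, Prod.snd_add, weakDual_add_apply, map_add]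
  ring

theorem natPairing_smul_right (a : ℝ) (v w : X × WeakDual ℝ X) :
    natPairing v (a • w) = a * natPairing v w := by
  simp only [natPairing, Prod.smul_fst, Prod.smul_snd, weakDual_smul_apply, map_smul, smul_eq_mul]
  ring

end Operators

/-! ### Separation, and the passage from NI to `T + N_C` -/

section Separation

variable {X : Type*} [AddCommGroup X] [Module ℝ X] [TopologicalSpace X]
  [IsTopologicalAddGroup X] [ContinuousSMul ℝ X] [LocallyConvexSpace ℝ X]
  {T : X → Set (WeakDual ℝ X)} {C : Set X} {h : X × WeakDual ℝ X → EReal}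

/-- A point outside a closed convex subset of `(X × X*) × ℝ` which is unbounded upwards and has a
non-vertical supporting functional is separated from that set by a non-vertical functional. -/
theorem exists_affine_minorant {G : Set ((X × WeakDual ℝ X) × ℝ)} (hconv : Convex ℝ G)
    (hclosed : IsClosed G) (hup : ∀ v r s, (v, r) ∈ G → r ≤ s → (v, s) ∈ G)
    (hne : G.Nonempty) {w₀ : X × WeakDual ℝ X} {b₀ : ℝ}
    (hmin : ∀ v r, (v, r) ∈ G → natPairing v w₀ - b₀ ≤ r)
    {z : X × WeakDual ℝ X} {a : ℝ} (hz : (z, a) ∉ G) :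
    ∃ (w : X × WeakDual ℝ X) (b : ℝ), (∀ v r, (v, r) ∈ G → natPairing v w - b ≤ r) ∧
      a < natPairing z w - b := by
  have : LocallyConvexSpace ℝ (WeakDual ℝ X) :=
    WeakBilin.locallyConvexSpace (B := topDualPairing ℝ X)
  obtain ⟨f, α, hfG, hfz⟩ := geometric_hahn_banach_closed_point hconv hclosed hz
  obtain ⟨w, s, hf⟩ := exists_eq_natPairing f
  simp only [hf] at hfz
  have hG : ∀ v r, (v, r) ∈ G → natPairing v w + s * r < α := fun v r hvr => by
    simpa only [hf] using hfG _ hvr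
  have hs : s ≤ 0 := by
    by_contra! hs
    obtain ⟨⟨v, r⟩, hvr⟩ := hne
    -- At height `(α - natPairing v w) / s` the functional already reaches `α`.
    have h1 := hG v _ (hup v r (max r ((α - natPairing v w) / s)) hvr (le_max_left _ _))
    have h2 : s * ((α - natPairing v w) / s) ≤ s * max r ((α - natPairing v w) / s) :=
      mul_le_mul_of_nonneg_left (le_max_right _ _) hs.le
    rw [mul_div_cancel₀ _ hs.ne'] at h2
    linarith
  -- adding a large multiple of the separating functional to the given one makes it non-vertical
  set e := natPairing z w + s * a - α with he
  have hepos : 0 < e := by rw [he]; linarith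
  obtain ⟨k, hk0, hk⟩ : ∃ k : ℝ, 0 ≤ k ∧ a - (natPairing z w₀ - b₀) < k * e := by
    refine ⟨max 0 ((a - (natPairing z w₀ - b₀)) / e + 1), le_max_left _ _, ?_⟩
    have h2 := mul_le_mul_of_nonneg_right
      (le_max_right 0 ((a - (natPairing z w₀ - b₀)) / e + 1)) hepos.le
    rw [add_mul, div_mul_cancel₀ _ hepos.ne'] at h2
    linarith
  -- In the combined inequality `r` has coefficient `1 - k * s ≥ 1`, so dividing by it gives an
  -- affine minorant.
  set c := 1 - k * s with hc
  have hcpos : 0 < c := by nlinarith [mul_nonneg hk0 (neg_nonneg.2 hs)]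
  have hval : ∀ v, natPairing v (c⁻¹ • (w₀ + k • w)) - c⁻¹ * (b₀ + k * α) =
      c⁻¹ * (natPairing v w₀ - b₀ + k * (natPairing v w - α)) := fun v => by
    rw [natPairing_smul_right, natPairing_add_right, natPairing_smul_right]
    ring
  refine ⟨c⁻¹ • (w₀ + k • w), c⁻¹ * (b₀ + k * α), fun v r hvr => ?_, ?_⟩
  · rw [hval, inv_mul_le_iff₀ hcpos, hc]
    have h1 := hmin v r hvr
    have h2 := mul_le_mul_of_nonneg_left (hG v r hvr).le hk0
    linarith
  · rw [hval, lt_inv_mul_iff₀ hcpos, hc]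
    rw [he] at hk
    linarith

/-- A point of `C × X*` outside the graph of `T + N_C` is strictly separated from `T` on `C`
by a point of `C × X*`. -/
theorem exists_separation (hC_closed : IsClosed C) (hC_convex : Convex ℝ C)
    (hTC : (dom T ∩ interior C).Nonempty) (hh : IsRepresentative h)
    (hhT : {z | h z = (coupling z : EReal)} ∩ C ×ˢ Set.univ = graph (restrict T C))
    {z : X × WeakDual ℝ X} (hzC : z.1 ∈ C) (hz : z ∉ graph (sum T (normalCone C))) :
    ∃ (w : X × WeakDual ℝ X) (b : ℝ), w.1 ∈ C ∧
      (∀ v ∈ graph (restrict T C), natPairing w v - coupling v ≤ b) ∧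
      b < natPairing z w - coupling z := by
  obtain ⟨u, ⟨u', hu'⟩, hu⟩ := hTC
  have huC := interior_subset hu
  have hne : C.Nonempty := ⟨u, huC⟩
  have hcontact : ∀ v ∈ graph (restrict T C), h v = (coupling v : EReal) := fun v hv => by
    rw [← hhT] at hv
    exact hv.1
  have hhu := hcontact (u, u') ⟨huC, hu'⟩
  have hmemG : ∀ v ∈ graph (restrict T C), ∀ (n : WeakDual ℝ X) (d : ℝ),
      (∀ y ∈ C, n (y - u) ≤ d) → ((v.1, v.2 + n), coupling v + d + n u) ∈ convEpi h C u := by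
    intro v hv n d hnd
    refine ⟨n, d, hv.1, hnd, ?_⟩
    rw [add_sub_cancel_right, add_right_comm, add_sub_cancel_right, add_sub_cancel_right]
    exact (hcontact v hv).le
  -- A witness `(n, d)` would turn `c ≤ h` and `n (z.1 - u) ≤ d` into equalities, so that `z.2 - n ∈
  -- T z.1` and `n` is normal to `C` at `z.1`.
  have hzG : (z, coupling z) ∉ convEpi h C u := by
    rintro ⟨n, d, -, hn, hle⟩
    refine hz ((mem_graph_sum_normalCone hne).2 ⟨hzC, z.2 - n, ?_, fun y hy => ?_⟩)
    all_goals
      have h1 := hn z.1 hzC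
      have h2 := EReal.coe_le_coe_iff.1 ((hh.coupling_le _).trans hle)
      simp only [coupling, map_sub, weakDual_sub_apply] at h1 h2
    · have hd : d = n z.1 - n u := by linarith
      have hc : h (z.1, z.2 - n) = (coupling (z.1, z.2 - n) : EReal) := by
        refine le_antisymm (hle.trans_eq ?_) (hh.coupling_le _)
        rw [EReal.coe_eq_coe_iff]
        simp only [coupling, weakDual_sub_apply]
        linarith
      have hmem : (z.1, z.2 - n) ∈ graph (restrict T C) := hhT ▸ ⟨hc, hzC, trivial⟩
      exact hmem.2
    · have h3 := hn y hy
      simp only [map_sub, weakDual_sub_apply] at h3 ⊢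
      linarith
  obtain ⟨w, b, hw, hzw⟩ := exists_affine_minorant (hh.convex_convEpi hC_convex u)
    (hh.isClosed_convEpi hC_closed hu hhu)
    (by
      rintro v r s ⟨n, d, hv, hn, hle⟩ hrs
      exact ⟨n, d, hv, hn, hle.trans (EReal.coe_le_coe_iff.2 (by simpa using hrs))⟩)
    ⟨_, hmemG (u, u') ⟨huC, hu'⟩ 0 0 fun _ _ => le_rfl⟩
    (w₀ := (u, u')) (b₀ := coupling (u, u'))
    (by
      rintro v r ⟨n, d, hv, hn, hle⟩
      have h1 := hh.natPairing_sub_coupling_le hhu hle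
      have h2 : 0 ≤ d := by simpa using hn u huC
      simp only [natPairing, coupling, weakDual_sub_apply] at h1 ⊢
      linarith)
    hzG
  refine ⟨w, b, ?_, fun v hv => ?_, by linarith⟩
  -- If `w.1 ∉ C`, a functional `n` separates it from `C`. Shifting `(u, u')` by `k • n` stays in
  -- the epigraph at a cost that, for large `k`, violates the minorant `w`.
  · by_contra hwC
    obtain ⟨f, α, hfC, hfw⟩ := geometric_hahn_banach_closed_point hC_convex hC_closed hwC
    set n : WeakDual ℝ X := StrongDual.toWeakDual f with hn
    have hnC : ∀ y ∈ C, n y < α := hfC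
    have hnw : α < n w.1 := hfw
    have hscale : ∀ k : ℝ, 0 ≤ k →
        k * (n w.1 - α) ≤ coupling (u, u') + b - natPairing (u, u') w := by
      intro k hk
      have h1 := hw _ _ (hmemG (u, u') ⟨huC, hu'⟩ (k • n) (k * (α - n u)) fun y hy => by
        rw [weakDual_smul_apply, map_sub]
        exact mul_le_mul_of_nonneg_left (by linarith [hnC y hy]) hk)
      simp only [natPairing, weakDual_add_apply, weakDual_smul_apply] at h1 ⊢
      linarith
    have hpos : 0 < n w.1 - α := by linarith
    have h0 := hscale 0 le_rfl
    rw [zero_mul] at h0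
    have h1 := hscale _ (div_nonneg (add_nonneg h0 zero_le_one) hpos.le)
    rw [div_mul_cancel₀ _ hpos.ne'] at h1
    linarith
  · have h1 := hw _ _ (hmemG v hv 0 0 fun _ _ => le_rfl)
    have h2 : (0 : WeakDual ℝ X) u = 0 := rfl
    have h3 : natPairing w v = natPairing v w := add_comm _ _
    simp only [add_zero, h2, Prod.mk.eta] at h1
    linarith

theorem subset_graph_of_isNIOn (hC_closed : IsClosed C) (hC_convex : Convex ℝ C)
    (hTC : (dom T ∩ interior C).Nonempty) (hh : IsRepresentative h)
    (hhT : {z | h z = (coupling z : EReal)} ∩ C ×ˢ Set.univ = graph (restrict T C))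
    (hNI : IsNIOn T C) :
    monRelated (restrict T C) ∩ C ×ˢ Set.univ ⊆ graph (sum T (normalCone C)) := by
  rintro z ⟨hz, hzC, -⟩
  by_contra hzT
  obtain ⟨w, b, hwC, hw, hb⟩ := exists_separation hC_closed hC_convex hTC hh hhT hzC hzT
  -- NI at `(1 - t) z + t w`, divided by `t`, gives `z · w - c z + t * B ≤ b`; letting `t → 0`
  -- contradicts the separation.
  refine hb.not_ge (le_of_forall_add_mul_le (B := coupling w + coupling z - natPairing z w) ?_)
  intro t ht0 ht1
  have hle : fitzpatrick (restrict T C) ((1 - t) • z + t • w) ≤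
      (((1 - t) * coupling z + t * b : ℝ) : EReal) := by
    refine fitzpatrick_le_coe.2 fun v hv => ?_
    have h1 := mul_le_mul_of_nonneg_left (mem_monRelated.1 hz v hv) (sub_nonneg.2 ht1.le)
    have h2 := mul_le_mul_of_nonneg_left (hw v hv) ht0.le
    simp only [natPairing, Prod.fst_add, Prod.snd_add, Prod.smul_fst, Prod.smul_snd, map_add,
      map_smul, weakDual_add_apply, weakDual_smul_apply, smul_eq_mul] at h1 h2 ⊢
    linarith
  have hmem : ((1 - t) • z + t • w).1 ∈ C :=
    hC_convex hzC hwC (sub_nonneg.2 ht1.le) ht0.le (by ring)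
  have hc := EReal.coe_le_coe_iff.1 ((hNI ⟨hmem, trivial⟩).trans hle)
  refine le_of_mul_le_mul_left ?_ ht0
  simp only [coupling, natPairing, Prod.fst_add, Prod.snd_add, Prod.smul_fst, Prod.smul_snd,
    map_add, map_smul, weakDual_add_apply, weakDual_smul_apply, smul_eq_mul] at hc ⊢
  linarith

end Separation

end MonotoneOp

/-! ### The equivalences and the maximality criterion -/

theorem theorem3p10 {X : Type*} [AddCommGroup X] [Module ℝ X] [TopologicalSpace X]
    [IsTopologicalAddGroup X] [ContinuousSMul ℝ X] [LocallyConvexSpace ℝ X] [T2Space X]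
    (T : X → Set (WeakDual ℝ X)) (C : Set X)
    (hC_closed : IsClosed C) (hC_convex : Convex ℝ C)
    (hTC : (MonotoneOp.dom T ∩ interior C).Nonempty)
    (hT : MonotoneOp.IsRepresentableOn T C) :
    List.TFAE
      [ MonotoneOp.Locates C T,
        MonotoneOp.IsNIOn T C,
        MonotoneOp.monRelated (MonotoneOp.restrict T C) ∩ C ×ˢ Set.univ ⊆
          MonotoneOp.graph (MonotoneOp.sum T (MonotoneOp.normalCone C)),
        MonotoneOp.Identifies C (MonotoneOp.sum T (MonotoneOp.normalCone C)) ] ∧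
    (MonotoneOp.IsMaximalMonotone (MonotoneOp.sum T (MonotoneOp.normalCone C)) ↔
      MonotoneOp.Locates C T ∧
        MonotoneOp.monRelated (MonotoneOp.sum T (MonotoneOp.normalCone C)) ⊆
          C ×ˢ Set.univ) ∧
    (MonotoneOp.IsMaximalMonotone (MonotoneOp.sum T (MonotoneOp.normalCone C)) ↔
      MonotoneOp.IsNIOn T C ∧
        MonotoneOp.monRelated (MonotoneOp.sum T (MonotoneOp.normalCone C)) ⊆
          C ×ˢ Set.univ) := by
  open MonotoneOp in
  obtain ⟨⟨x, hxC, -⟩, h, hh, hhT⟩ := hT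
  have hC : C.Nonempty := ⟨x, hxC⟩
  have hcontact : ∀ v ∈ graph (restrict T C), h v = (coupling v : EReal) := fun v hv => by
    rw [← hhT] at hv
    exact hv.1
  have hmono : IsMonotone (sum T (normalCone C)) :=
    IsMonotone.sum_normalCone hC fun z hz w hw => hh.monotone (hcontact z hz) (hcontact w hw)
  have hNI_sub := subset_graph_of_isNIOn hC_closed hC_convex hTC hh hhT
  have hLoc_NI : Locates C T ↔ IsNIOn T C :=
    ⟨Locates.isNIOn, fun hNI => locates_of_subset_graph hC (hNI_sub hNI)⟩
  have hNI_iff : IsNIOn T C ↔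
      monRelated (restrict T C) ∩ C ×ˢ Set.univ ⊆ graph (sum T (normalCone C)) :=
    ⟨hNI_sub, fun hsub => (locates_of_subset_graph hC hsub).isNIOn⟩
  have hmax : IsMaximalMonotone (sum T (normalCone C)) ↔
      IsNIOn T C ∧ monRelated (sum T (normalCone C)) ⊆ C ×ˢ Set.univ := by
    rw [hmono.isMaximalMonotone_iff, hNI_iff, ← monRelated_sum_normalCone_inter hC]
    refine ⟨fun hsub => ⟨Set.inter_subset_left.trans hsub, fun z hz => ?_⟩, ?_⟩
    · exact ⟨((mem_graph_sum_normalCone hC).1 (hsub hz)).1, trivial⟩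
    · exact fun hsub z hz => hsub.1 ⟨hz, hsub.2 hz⟩
  refine ⟨?_, by rw [hLoc_NI]; exact hmax, hmax⟩
  tfae_have 1 ↔ 2 := hLoc_NI
  tfae_have 2 ↔ 3 := hNI_iff
  tfae_have 4 ↔ 3 := identifies_sum_normalCone_iff hC
  tfae_finish
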